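/- Let $n\ge 2$, $1<p<\infty$ and $0<s<\min\{1,n/p\}$. Let $G$ be a John domain in $\mathbb{R}^n$, that is, a bounded domain (non-empty connected open set) for which there exist a point $x_0\in G$ and a constant $\beta\ge 1$ such that every $x\in G$ can be joined to $x_0$ by a rectifiable curve $\gamma:[0,\ell]\to G$ parametrized by its arc length with $\gamma(0)=x$, $\gamma(\ell)=x_0$, $\ell\le \beta\,\mathrm{diam}(G)$ and $\mathrm{dist}(\gamma(t),\partial G)\ge t/\beta$ for all $t\in[0,\ell]$. For a closed set $E\subset\mathbb{R}^n$ with empty interior, let $\mathcal{A}(E)$ be the set of all $0<t\le n$ for which there is a constant $c>0$ with $$\int_{B(x,r)}\mathrm{dist}(y,E)^{t-n}\,dy\le c\,r^{t}\qquad\text{for all } x\in E \text{ and all } 0<r<\infty,$$ and let $\dim_{\mathcal{A}}(E)=\inf\mathcal{A}(E)$ be the Aikawa dimension of $E$. (For $t=n$ the integrand is read as $1$.) Suppose that $\dim_{\mathcal{A}}(\partial G)<n-sp$. Then there is a constant $C>0$, depending only on $n$, $s$, $p$ and $G$, such that for every (real- or complex-valued) $f\in L^p(G)$, $$\left(\int_G\frac{|f(x)|^p}{\mathrm{dist}(x,\partial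 G)^{sp}}\,dx\right)^{1/p}\le C\left\{\|f\|_{L^p(G)}+\left(\int_G\int_G\frac{|f(x)-f(y)|^p}{|x-y|^{n+sp}}\,dy\,dx\right)^{1/p}\right\},$$ where the right-hand side may be infinite. -/

import Mathlib

open MeasureTheory Metric Set
open scoped ENNReal

/-- `G` is a John domain: a bounded domain (nonempty connected open set) with a John center `x₀`
and a constant `β ≥ 1` such that each `x ∈ G` is joined to `x₀` by a rectifiable curve in `G`,
parametrized by arc length on `[0, L]`, of length `L ≤ β diam G`, with
`dist (γ t) ∂G ≥ t / β` along the curve. (`HasUnitSpeedOn γ (Icc 0 L)` says that the length of `γ`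
on each subinterval `[a, b]` of `[0, L]` is `b - a`; in particular `γ` is continuous there.) -/
def IsJohnDomain {n : ℕ} (G : Set (EuclideanSpace ℝ (Fin n))) : Prop :=
  IsOpen G ∧ IsConnected G ∧ Bornology.IsBounded G ∧
    ∃ x₀ ∈ G, ∃ β : ℝ, 1 ≤ β ∧ ∀ x ∈ G, ∃ (L : ℝ) (γ : ℝ → EuclideanSpace ℝ (Fin n)),
      0 ≤ L ∧ HasUnitSpeedOn γ (Icc 0 L) ∧ (∀ t ∈ Icc 0 L, γ t ∈ G) ∧
      γ 0 = x ∧ γ L = x₀ ∧ L ≤ β * diam G ∧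
      ∀ t ∈ Icc 0 L, t / β ≤ infDist (γ t) (frontier G)

/-- The set `𝒜(E)` of all `0 < t ≤ n` such that, for some `C > 0`,
`∫_{B(x,r)} dist(y, E)^(t - n) dy ≤ C r^t` for all `x ∈ E` and `0 < r < ∞`.
It is meant for closed sets `E` with empty interior. The integral takes values in `[0, ∞]`, and
the integrand is `∞` on `E` if `t < n` and identically `1` if `t = n`. -/
def aikawaSet {n : ℕ} (E : Set (EuclideanSpace ℝ (Fin n))) : Set ℝ :=
  {t | 0 < t ∧ t ≤ n ∧ ∃ C : ℝ, 0 < C ∧ ∀ x ∈ E, ∀ r : ℝ, 0 < r →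
    ∫⁻ y in ball x r, infEDist y E ^ (t - n) ≤ ENNReal.ofReal (C * r ^ t)}

/-- `n` always belongs to `𝒜(E)`, so that the infimum below is over a nonempty subset of
`(0, n]`. -/
theorem natCast_mem_aikawaSet {n : ℕ} (hn : 0 < n) (E : Set (EuclideanSpace ℝ (Fin n))) :
    (n : ℝ) ∈ aikawaSet E := by
  have : Nonempty (Fin n) := ⟨⟨0, hn⟩⟩
  refine ⟨by exact_mod_cast hn, le_rfl,
    (volume (ball (0 : EuclideanSpace ℝ (Fin n)) 1)).toReal,
    ENNReal.toReal_pos (measure_ball_pos _ _ one_pos).ne' measure_ball_lt_top.ne, ?_⟩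
  intro x _ r hr
  rw [ENNReal.ofReal_mul ENNReal.toReal_nonneg, ENNReal.ofReal_toReal measure_ball_lt_top.ne]
  simp only [sub_self, ENNReal.rpow_zero, lintegral_const, one_mul, Measure.restrict_apply_univ]
  rw [Measure.addHaar_ball volume x hr.le, finrank_euclideanSpace, Fintype.card_fin,
    Real.rpow_natCast, mul_comm]

/-- The Aikawa dimension `inf 𝒜(E)` of a closed set `E ⊆ ℝⁿ` with empty interior. -/
noncomputable def aikawaDim {n : ℕ} (E : Set (EuclideanSpace ℝ (Fin n))) : ℝ :=
  sInf (aikawaSet E)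

/-- The `[0, ∞]`-valued seminorm `|f|_{W^{s,p}(G)}` of fractional Sobolev spaces. -/
noncomputable def fracSeminorm {n : ℕ} {𝕜 : Type*} [RCLike 𝕜] (s p : ℝ)
    (G : Set (EuclideanSpace ℝ (Fin n))) (f : EuclideanSpace ℝ (Fin n) → 𝕜) : ℝ≥0∞ :=
  (∫⁻ x in G, ∫⁻ y in G, ‖f x - f y‖ₑ ^ p / edist x y ^ (n + s * p)) ^ (1 / p)

/-!
Write `d x = infDist x (frontier G)` and `σ = s * p`. The inequality is proved by an absorption
argument that compares `f x` with the values of `f` at points much farther from the boundary.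

The John condition enters only through interior plumpness (`IsJohnDomain.exists_plump`): every
ball `B(x, ρ)` with `x ∈ G` and `ρ` not too large contains a point `z ∈ G` with `d z ≥ ρ / β`.
Fix a large `N`. For `x` close to the boundary, plumpness at the scale `ρ = N * d x` shows that the
set `A x` (`accessiblePoints`) of points `y ∈ G` with `|x - y| < 2 ρ` and `d y > ρ / (2 β)` has
measure at least a constant times `(N * d x) ^ n`. Averaging
`|f x| ^ p ≤ 2 ^ p * (|f y| ^ p + |f x - f y| ^ p)` over `y ∈ A x`, multiplying by `d x ^ (-σ)` and
integrating in `x` gives two terms.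

* In the term with `|f x - f y| ^ p` one has `|x - y| < 2 N d x`, so it is bounded by a multiple
  of the double integral defining the fractional seminorm; the points `x` and `y` need not be
  joined by a chain of balls, because that double integral runs over all of `G × G`.
* In the term with `|f y| ^ p` the order of integration is exchanged. The points `x` with `y ∈ A x`
  satisfy `d x ≥ d y / (3 N)` and lie in a ball of radius comparable to `d y` about a boundary
  point, so the Aikawa condition with an exponent `t < n - σ` bounds the term by a constant times
  `N ^ (σ + t - n) * ∫ |f y| ^ p * d y ^ (-σ)` (`lintegral_lintegral_accessiblePoints_le`).

Since `σ + t < n`, a large `N` makes the last constant at most `1 / 2`. As `d y > d x` for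
`y ∈ A x`, all this may be done on `{d > ε}`, where the left-hand side is finite because
`f ∈ L^p(G)`; it is then absorbed (`exists_truncated_hardy`), and `ε → 0` by monotone convergence.
-/

section

open Filter

variable {n : ℕ} {G : Set (EuclideanSpace ℝ (Fin n))}

/-! ### Distance to the boundary and plumpness of John domains -/

theorem ball_subset_of_le_infDist_frontier (hG : IsOpen G) {z : EuclideanSpace ℝ (Fin n)}
    (hz : z ∈ G) {r : ℝ} (hr : r ≤ infDist z (frontier G)) : ball z r ⊆ G := by
  rcases le_or_gt r 0 with hr0 | hr0
  · simp [ball_eq_empty.2 hr0]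
  refine (convex_ball z r).isPreconnected.subset_left_of_subset_union hG
    isClosed_closure.isOpen_compl (v := (closure G)ᶜ)
    (disjoint_compl_right.mono_left subset_closure) ?_ ⟨z, mem_ball_self hr0, hz⟩
  intro w hw
  by_contra hw'
  simp only [mem_union, mem_compl_iff, not_or, not_not] at hw'
  have hwf : w ∈ frontier G := by rw [hG.frontier_eq]; exact ⟨hw'.2, hw'.1⟩
  have := infDist_le_dist_of_mem (x := z) hwf
  rw [mem_ball, dist_comm] at hw
  linarith

theorem infDist_frontier_pos (hG : IsOpen G) (hF : (frontier G).Nonempty)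
    {x : EuclideanSpace ℝ (Fin n)} (hx : x ∈ G) : 0 < infDist x (frontier G) := by
  rw [← infDist_pos_iff_notMem_closure hF, isClosed_frontier.closure_eq, hG.frontier_eq]
  exact fun h => h.2 hx

theorem infEDist_frontier_rpow (hG : IsOpen G) (hF : (frontier G).Nonempty)
    {x : EuclideanSpace ℝ (Fin n)} (hx : x ∈ G) (a : ℝ) :
    infEDist x (frontier G) ^ a = ENNReal.ofReal (infDist x (frontier G) ^ a) := by
  rw [← ENNReal.ofReal_rpow_of_pos (infDist_frontier_pos hG hF hx), infDist,
    ENNReal.ofReal_toReal (infEDist_ne_top hF)]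

/-- John domains are plump from the inside: the point of the John curve starting at `x` with
parameter `ρ` is within `ρ` of `x` and at distance at least `ρ / β` from the boundary. The curve is
long enough for this because it ends at the John center, whose distance to the boundary is `R`. -/
theorem IsJohnDomain.exists_plump (hG : IsJohnDomain G) (hF : (frontier G).Nonempty) :
    ∃ β : ℝ, 1 ≤ β ∧ ∃ R : ℝ, 0 < R ∧ ∀ x ∈ G, ∀ ρ : ℝ, 0 ≤ ρ → ρ + infDist x (frontier G) ≤ R →
      ∃ z ∈ G, dist x z ≤ ρ ∧ ρ / β ≤ infDist z (frontier G) := by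
  obtain ⟨hGo, -, -, x₀, hx₀, β, hβ, h⟩ := hG
  refine ⟨β, hβ, infDist x₀ (frontier G), infDist_frontier_pos hGo hF hx₀, ?_⟩
  intro x hx ρ hρ hρR
  obtain ⟨L, γ, hL, hγ, hγG, hγ0, hγL, -, hγd⟩ := h x hx
  have hdist : ∀ t ∈ Icc 0 L, dist x (γ t) ≤ t := by
    intro t ht
    have h1 := hγ (left_mem_Icc.2 hL) ht
    have h2 := eVariationOn.edist_le γ (s := Icc 0 L ∩ Icc 0 t)
      ⟨left_mem_Icc.2 hL, left_mem_Icc.2 ht.1⟩ ⟨ht, right_mem_Icc.2 ht.1⟩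
    rw [h1, hγ0, NNReal.coe_one, one_mul, sub_zero, edist_dist] at h2
    exact (ENNReal.ofReal_le_ofReal_iff ht.1).1 h2
  have hx₀x : infDist x₀ (frontier G) ≤ infDist x (frontier G) + L := by
    have h1 := hdist L (right_mem_Icc.2 hL)
    rw [hγL, dist_comm] at h1
    exact (infDist_le_infDist_add_dist (y := x)).trans (by linarith)
  have hmem : ρ ∈ Icc 0 L := ⟨hρ, by linarith⟩
  exact ⟨γ ρ, hγG ρ hmem, hdist ρ hmem, hγd ρ hmem⟩

/-! ### Consequence of the Aikawa condition -/

/-- The Aikawa condition with exponent `t`, applied in a ball of radius comparable to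
`infDist y (frontier G)` about a boundary point near `y`. On the domain of integration the excess
power `-(σ + t)` of the distance is controlled by its value at the lower bound
`a * infDist y (frontier G)`. -/
theorem setLIntegral_infDist_rpow_le (hG : IsOpen G) (hF : (frontier G).Nonempty) {t C σ : ℝ}
    (hσt : 0 ≤ σ + t)
    (hC : ∀ x ∈ frontier G, ∀ r : ℝ, 0 < r →
      ∫⁻ y in ball x r, infEDist y (frontier G) ^ (t - n) ≤ ENNReal.ofReal (C * r ^ t))
    {a b : ℝ} (ha : 0 < a) (hb : 0 ≤ b) {y : EuclideanSpace ℝ (Fin n)} (hy : y ∈ G) :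
    ∫⁻ x in {x ∈ G | a * infDist y (frontier G) ≤ infDist x (frontier G) ∧
        dist x y ≤ b * infDist y (frontier G)},
      ENNReal.ofReal (infDist x (frontier G) ^ (-(σ + n))) ≤
    ENNReal.ofReal (a ^ (-(σ + t)) * (C * (b + 2) ^ t) * infDist y (frontier G) ^ (-σ)) := by
  have hdy := infDist_frontier_pos hG hF hy
  set d := infDist y (frontier G) with hd
  obtain ⟨w, hw, hyw⟩ := (infDist_lt_iff hF).1 (show infDist y (frontier G) < 2 * d by linarith)
  have hsub : {x ∈ G | a * d ≤ infDist x (frontier G) ∧ dist x y ≤ b * d} ⊆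
      ball w ((b + 2) * d) := by
    rintro x ⟨-, -, hx⟩
    rw [mem_ball]
    linarith [dist_triangle x y w]
  have hmeas : MeasurableSet {x ∈ G | a * d ≤ infDist x (frontier G) ∧ dist x y ≤ b * d} :=
    hG.measurableSet.inter ((measurableSet_le measurable_const measurable_infDist).inter
      (measurableSet_le (measurable_id.dist measurable_const) measurable_const))
  calc _ ≤ ∫⁻ x in {x ∈ G | a * d ≤ infDist x (frontier G) ∧ dist x y ≤ b * d},
        ENNReal.ofReal ((a * d) ^ (-(σ + t))) * infEDist x (frontier G) ^ (t - n) := by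
        refine setLIntegral_mono' hmeas ?_
        rintro x ⟨hx, hxa, -⟩
        have hdx := infDist_frontier_pos hG hF hx
        rw [infEDist_frontier_rpow hG hF hx, ← ENNReal.ofReal_mul (by positivity)]
        refine ENNReal.ofReal_le_ofReal ?_
        rw [show -(σ + n) = -(σ + t) + (t - n) by ring, Real.rpow_add hdx]
        gcongr ?_ * _
        exact Real.rpow_le_rpow_of_nonpos (by positivity) hxa (by linarith)
    _ ≤ ENNReal.ofReal ((a * d) ^ (-(σ + t))) *
        ∫⁻ x in ball w ((b + 2) * d), infEDist x (frontier G) ^ (t - n) := by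
        rw [lintegral_const_mul _ (by fun_prop)]
        gcongr
    _ ≤ ENNReal.ofReal ((a * d) ^ (-(σ + t))) * ENNReal.ofReal (C * ((b + 2) * d) ^ t) := by
        gcongr
        exact hC w hw _ (by positivity)
    _ = _ := by
        rw [← ENNReal.ofReal_mul (by positivity), Real.mul_rpow ha.le hdy.le,
          Real.mul_rpow (by positivity) hdy.le, show -σ = -(σ + t) + t by ring,
          Real.rpow_add hdy]
        congr 1
        ring

/-! ### Averages over points far from the boundary -/

/-- The points `y ∈ G` within `2 * ρ` of `x` and farther than `ρ / (2 * β)` from the boundary, where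
`ρ = N * infDist x (frontier G)`. The set replaces the ball about a point of a John curve in
averages: unlike such a ball it involves no choice, so it depends measurably on `x`. -/
def accessiblePoints (G : Set (EuclideanSpace ℝ (Fin n))) (N β : ℝ)
    (x : EuclideanSpace ℝ (Fin n)) : Set (EuclideanSpace ℝ (Fin n)) :=
  {y ∈ G | dist x y < 2 * (N * infDist x (frontier G)) ∧
    N * infDist x (frontier G) < 2 * β * infDist y (frontier G)}

theorem measurableSet_accessiblePoints (hG : IsOpen G) (N β : ℝ) :
    MeasurableSet {q : EuclideanSpace ℝ (Fin n) × EuclideanSpace ℝ (Fin n) |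
      q.2 ∈ accessiblePoints G N β q.1} := by
  have h : Measurable fun x : EuclideanSpace ℝ (Fin n) => infDist x (frontier G) :=
    measurable_infDist
  have h₁ : Measurable fun q : EuclideanSpace ℝ (Fin n) × EuclideanSpace ℝ (Fin n) =>
      infDist q.1 (frontier G) := h.comp measurable_fst
  have h₂ : Measurable fun q : EuclideanSpace ℝ (Fin n) × EuclideanSpace ℝ (Fin n) =>
      infDist q.2 (frontier G) := h.comp measurable_snd
  exact (measurable_snd hG.measurableSet).inter
    ((measurableSet_lt (measurable_fst.dist measurable_snd) ((h₁.const_mul N).const_mul 2)).inter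
      (measurableSet_lt (h₁.const_mul N) (h₂.const_mul (2 * β))))

/-- A plumpness point `z` at the scale `ρ = N * infDist x (frontier G)` forces
`accessiblePoints G N β x` to contain the ball `B(z, ρ / (2 * β))`. -/
theorem le_volume_accessiblePoints [NeZero n] (hG : IsOpen G) {β N : ℝ} (hβ : 1 ≤ β)
    {x z : EuclideanSpace ℝ (Fin n)} (hN : 0 < N * infDist x (frontier G)) (hz : z ∈ G)
    (hxz : dist x z ≤ N * infDist x (frontier G))
    (hzd : N * infDist x (frontier G) / β ≤ infDist z (frontier G)) :
    ENNReal.ofReal ((N / (2 * β)) ^ n * infDist x (frontier G) ^ n) *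
      volume (ball (0 : EuclideanSpace ℝ (Fin n)) 1) ≤ volume (accessiblePoints G N β x) := by
  set ρ := N * infDist x (frontier G) with hρ
  have hβ0 : 0 < β := by linarith
  have hr : 0 ≤ ρ / (2 * β) := by positivity
  have hsplit : ρ / β = 2 * (ρ / (2 * β)) := by field_simp
  have hρβ : ρ / (2 * β) < ρ := by
    rw [div_lt_iff₀ (by positivity)]; nlinarith
  have h := Measure.addHaar_ball volume z hr
  rw [finrank_euclideanSpace, Fintype.card_fin] at h
  rw [← mul_pow, show N / (2 * β) * infDist x (frontier G) = ρ / (2 * β) by rw [hρ]; ring, ← h]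
  refine measure_mono fun y hy => ⟨?_, ?_, ?_⟩
  · exact ball_subset_of_le_infDist_frontier hG hz (by linarith) hy
  · rw [mem_ball, dist_comm] at hy
    linarith [dist_triangle x z y]
  · rw [mem_ball, dist_comm] at hy
    have h1 : infDist z (frontier G) ≤ infDist y (frontier G) + dist z y :=
      infDist_le_infDist_add_dist
    have h2 : ρ / (2 * β) < infDist y (frontier G) := by linarith
    rw [div_lt_iff₀ (by positivity)] at h2
    linarith

/-- The volume bound `le_volume_accessiblePoints` as an inequality for the constant function `u`;
it is applied with `u = ‖f x‖ₑ ^ p`. -/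
theorem rpow_mul_le_lintegral_accessiblePoints [NeZero n] (hG : IsOpen G)
    (hF : (frontier G).Nonempty) {β N σ : ℝ} (hβ : 1 ≤ β) (hN : 0 < N)
    {x z : EuclideanSpace ℝ (Fin n)} (hx : x ∈ G) (hz : z ∈ G)
    (hxz : dist x z ≤ N * infDist x (frontier G))
    (hzd : N * infDist x (frontier G) / β ≤ infDist z (frontier G)) (u : ℝ≥0∞) :
    u * ENNReal.ofReal (infDist x (frontier G) ^ (-σ)) ≤
      ENNReal.ofReal ((2 * β) ^ n / (volume (ball (0 : EuclideanSpace ℝ (Fin n)) 1)).toReal *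
          N ^ (-(n : ℝ))) *
        (ENNReal.ofReal (infDist x (frontier G) ^ (-(σ + n))) *
          ∫⁻ _y in accessiblePoints G N β x, u) := by
  have hd := infDist_frontier_pos hG hF hx
  have hvol := le_volume_accessiblePoints hG hβ (by positivity) hz hxz hzd
  have hv : 0 < (volume (ball (0 : EuclideanSpace ℝ (Fin n)) 1)).toReal :=
    ENNReal.toReal_pos (measure_ball_pos _ _ one_pos).ne' measure_ball_lt_top.ne
  rw [← ENNReal.ofReal_toReal (measure_ball_lt_top (μ := volume)
    (x := (0 : EuclideanSpace ℝ (Fin n))) (r := 1)).ne,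
    ← ENNReal.ofReal_mul (by positivity)] at hvol
  set v := (volume (ball (0 : EuclideanSpace ℝ (Fin n)) 1)).toReal
  set d := infDist x (frontier G)
  rw [setLIntegral_const]
  calc u * ENNReal.ofReal (d ^ (-σ))
      = ENNReal.ofReal ((2 * β) ^ n / v * N ^ (-(n : ℝ))) * (ENNReal.ofReal (d ^ (-(σ + n))) *
        (u * ENNReal.ofReal ((N / (2 * β)) ^ n * d ^ n * v))) := by
        have hmul : d ^ (-σ) = ((2 * β) ^ n / v * N ^ (-(n : ℝ))) *
            (d ^ (-(σ + n)) * ((N / (2 * β)) ^ n * d ^ n * v)) := by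
          rw [show -(σ + n) = -σ + -(n : ℝ) by ring, Real.rpow_add hd, Real.rpow_neg hd.le n,
            Real.rpow_neg hN.le, Real.rpow_natCast, Real.rpow_natCast, div_pow]
          field_simp
        rw [hmul, ENNReal.ofReal_mul (p := (2 * β) ^ n / v * N ^ (-(n : ℝ))) (by positivity),
          ENNReal.ofReal_mul (p := d ^ (-(σ + n))) (by positivity)]
        ring
    _ ≤ _ := by gcongr

theorem enorm_rpow_le_two_rpow_mul {E : Type*} [NormedAddCommGroup E] (a b : E) {p : ℝ}
    (hp : 0 ≤ p) : ‖a‖ₑ ^ p ≤ 2 ^ p * (‖b‖ₑ ^ p + ‖a - b‖ₑ ^ p) := by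
  refine le_trans ?_ (ENNReal.add_rpow_le_two_rpow_mul_rpow_add_rpow _ _ hp)
  gcongr
  calc ‖a‖ₑ = ‖b + (a - b)‖ₑ := by rw [add_sub_cancel]
    _ ≤ _ := enorm_add_le _ _

theorem ofReal_rpow_mul_le_div_edist (hG : IsOpen G) (hF : (frontier G).Nonempty) {β N q : ℝ}
    (hq : 0 ≤ q) (hN : 0 < N) {x y : EuclideanSpace ℝ (Fin n)} (hx : x ∈ G)
    (hy : y ∈ accessiblePoints G N β x) (u : ℝ≥0∞) :
    ENNReal.ofReal (infDist x (frontier G) ^ (-q)) * u ≤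
      ENNReal.ofReal ((2 * N) ^ q) * (u / edist x y ^ q) := by
  have hd := infDist_frontier_pos hG hF hx
  set d := infDist x (frontier G)
  have hxy : edist x y ≤ ENNReal.ofReal (2 * N * d) := by
    rw [edist_dist]
    exact ENNReal.ofReal_le_ofReal (by linarith [hy.2.1])
  have hpow : edist x y ^ q ≤ ENNReal.ofReal ((2 * N * d) ^ q) := by
    rw [← ENNReal.ofReal_rpow_of_pos (by positivity)]
    gcongr
  calc ENNReal.ofReal (d ^ (-q)) * u
      = ENNReal.ofReal ((2 * N) ^ q) * (u / ENNReal.ofReal ((2 * N * d) ^ q)) := by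
        rw [div_eq_mul_inv, ← ENNReal.ofReal_inv_of_pos (by positivity),
          show d ^ (-q) = (2 * N) ^ q * ((2 * N * d) ^ q)⁻¹ by
            rw [Real.mul_rpow (by positivity) hd.le, Real.rpow_neg hd.le]; field_simp,
          ENNReal.ofReal_mul (by positivity)]
        ring
    _ ≤ _ := by gcongr

/-! ### The two terms of the average -/

/-- Averages of `g` over accessible points, integrated against the weight, are controlled by the
weighted integral of `g` itself. With the factor `N ^ (-n)` that normalizes the averages, the
constant is a multiple of `N ^ (σ + t - n)`, hence small for large `N` if `σ + t < n`. The
hypothesis `2 * β ≤ N` makes accessible points of `x` at least as far from the boundary as `x`, so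
that the truncation at `ε` is preserved. -/
theorem lintegral_lintegral_accessiblePoints_le (hG : IsOpen G) (hF : (frontier G).Nonempty)
    {t C σ β N ε : ℝ} (hσt : 0 ≤ σ + t)
    (hC : ∀ x ∈ frontier G, ∀ r : ℝ, 0 < r →
      ∫⁻ y in ball x r, infEDist y (frontier G) ^ (t - n) ≤ ENNReal.ofReal (C * r ^ t))
    (hβ : 1 ≤ β) (hN : 2 * β ≤ N) {g : EuclideanSpace ℝ (Fin n) → ℝ≥0∞}
    (hg : AEMeasurable g (volume.restrict G)) :
    ∫⁻ x in {x ∈ G | ε < infDist x (frontier G)},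
      (ENNReal.ofReal (infDist x (frontier G) ^ (-(σ + n))) *
        ∫⁻ y in accessiblePoints G N β x, g y) ≤
    ENNReal.ofReal ((3 * N)⁻¹ ^ (-(σ + t)) * (C * (4 * β + 2) ^ t)) *
      ∫⁻ y in {y ∈ G | ε < infDist y (frontier G)},
        g y * ENNReal.ofReal (infDist y (frontier G) ^ (-σ)) := by
  have hS : MeasurableSet {x ∈ G | ε < infDist x (frontier G)} :=
    hG.measurableSet.inter (measurableSet_lt measurable_const measurable_infDist)
  set S := {x ∈ G | ε < infDist x (frontier G)} with hSdef
  have hSG : S ⊆ G := fun x hx => hx.1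
  have hN0 : 0 < N := by linarith
  have hA := measurableSet_accessiblePoints hG N β
  have hAx : ∀ x, MeasurableSet (accessiblePoints G N β x) := fun x =>
    measurable_prodMk_left hA
  let k : EuclideanSpace ℝ (Fin n) → EuclideanSpace ℝ (Fin n) → ℝ≥0∞ := fun x y =>
    {q : EuclideanSpace ℝ (Fin n) × EuclideanSpace ℝ (Fin n) |
      q.2 ∈ accessiblePoints G N β q.1}.indicator
      (fun q => ENNReal.ofReal (infDist q.1 (frontier G) ^ (-(σ + n))) * g q.2) (x, y)
  have hw : Measurable fun x : EuclideanSpace ℝ (Fin n) =>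
      ENNReal.ofReal (infDist x (frontier G) ^ (-(σ + n))) :=
    (measurable_infDist.pow_const _).ennreal_ofReal
  have hk : AEMeasurable (Function.uncurry k) ((volume.restrict S).prod (volume.restrict S)) :=
    ((hw.comp measurable_fst).aemeasurable.mul
      (hg.mono_measure (Measure.restrict_mono hSG le_rfl)).comp_snd).indicator hA
  -- All integrals over accessible points of `x ∈ S` are integrals over subsets of `S`.
  have hAS : ∀ x ∈ S, accessiblePoints G N β x ⊆ S := by
    rintro x ⟨hx, hxε⟩ y ⟨hy, -, hy2⟩
    refine ⟨hy, hxε.trans ?_⟩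
    have := infDist_nonneg (x := x) (s := frontier G)
    nlinarith
  calc _ = ∫⁻ x in S, ∫⁻ y in S, k x y := by
        refine setLIntegral_congr_fun hS fun x hx => ?_
        have hkx : (fun y => k x y) = (accessiblePoints G N β x).indicator
            (fun y => ENNReal.ofReal (infDist x (frontier G) ^ (-(σ + n))) * g y) := rfl
        simp only [hkx]
        rw [lintegral_indicator (hAx x), Measure.restrict_restrict (hAx x),
          inter_eq_left.2 (hAS x hx), lintegral_const_mul' _ _ ENNReal.ofReal_ne_top]
    _ = ∫⁻ y in S, ∫⁻ x in S, k x y := lintegral_lintegral_swap hk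
    _ ≤ ∫⁻ y in S, ENNReal.ofReal ((3 * N)⁻¹ ^ (-(σ + t)) * (C * (4 * β + 2) ^ t)) *
          (g y * ENNReal.ofReal (infDist y (frontier G) ^ (-σ))) := by
        refine setLIntegral_mono' hS fun y hy => ?_
        have hdy := infDist_frontier_pos hG hF hy.1
        have key := setLIntegral_infDist_rpow_le hG hF hσt hC (a := (3 * N)⁻¹) (b := 4 * β)
          (by positivity) (by positivity) hy.1
        set B := {x ∈ G | (3 * N)⁻¹ * infDist y (frontier G) ≤ infDist x (frontier G) ∧
          dist x y ≤ 4 * β * infDist y (frontier G)} with hB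
        have hBmeas : MeasurableSet B :=
          hG.measurableSet.inter ((measurableSet_le measurable_const measurable_infDist).inter
            (measurableSet_le (measurable_id.dist measurable_const) measurable_const))
        calc ∫⁻ x in S, k x y
            ≤ ∫⁻ x in S, B.indicator (fun x =>
              ENNReal.ofReal (infDist x (frontier G) ^ (-(σ + n))) * g y) x := by
              refine setLIntegral_mono' hS fun x hx => ?_
              by_cases hxy : y ∈ accessiblePoints G N β x
              · have hxB : x ∈ B := by
                  have h1 : infDist y (frontier G) ≤ infDist x (frontier G) + dist y x :=
                    infDist_le_infDist_add_dist
                  rw [dist_comm] at h1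
                  have hdx := infDist_frontier_pos hG hF hx.1
                  refine ⟨hx.1, ?_, by linarith [hxy.2.1, hxy.2.2]⟩
                  rw [inv_mul_le_iff₀ (by positivity)]
                  nlinarith [hxy.2.1]
                rw [indicator_of_mem hxB]
                exact indicator_le_self _ _ _
              · have : k x y = 0 := indicator_of_notMem (by exact hxy) _
                rw [this]; exact zero_le
          _ ≤ ∫⁻ x in B, ENNReal.ofReal (infDist x (frontier G) ^ (-(σ + n))) * g y := by
              rw [← lintegral_indicator hBmeas]
              exact setLIntegral_le_lintegral _ _
          _ = (∫⁻ x in B, ENNReal.ofReal (infDist x (frontier G) ^ (-(σ + n)))) * g y :=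
              lintegral_mul_const _ hw
          _ ≤ _ := by
              refine (mul_le_mul_left key _).trans_eq ?_
              rw [ENNReal.ofReal_mul' (by positivity)]
              ring
    _ = _ := lintegral_const_mul' _ _ ENNReal.ofReal_ne_top

theorem aemeasurable_mul_lintegral_accessiblePoints (hG : IsOpen G) (N β q : ℝ)
    {g : EuclideanSpace ℝ (Fin n) → ℝ≥0∞} (hg : AEMeasurable g (volume.restrict G)) :
    AEMeasurable (fun x => ENNReal.ofReal (infDist x (frontier G) ^ q) *
      ∫⁻ y in accessiblePoints G N β x, g y) (volume.restrict G) := by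
  have hA := measurableSet_accessiblePoints hG N β
  have hAx : ∀ x, MeasurableSet (accessiblePoints G N β x) := fun x =>
    measurable_prodMk_left hA
  refine (measurable_infDist.pow_const _).ennreal_ofReal.aemeasurable.mul ?_
  have hk := ((hg.comp_snd (μ := volume.restrict G)).indicator hA).lintegral_prod_right'
  convert! hk using 2 with x
  have hkx : (fun y => {q : EuclideanSpace ℝ (Fin n) × EuclideanSpace ℝ (Fin n) |
      q.2 ∈ accessiblePoints G N β q.1}.indicator (fun q => g q.2) (x, y)) =
      (accessiblePoints G N β x).indicator g := rfl
  rw [hkx, lintegral_indicator (hAx x), Measure.restrict_restrict (hAx x),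
    inter_eq_left.2 fun y hy => hy.1]

/-- The pointwise inequality behind the absorption argument, at a point `x` for which a plumpness
point `z` at the scale `N * infDist x (frontier G)` exists. -/
theorem rpow_enorm_mul_le [NeZero n] {𝕜 : Type*} [NormedAddCommGroup 𝕜] (hG : IsOpen G)
    (hF : (frontier G).Nonempty) {β N σ p : ℝ} (hβ : 1 ≤ β) (hN : 0 < N) (hσ : 0 ≤ σ)
    (hp : 0 ≤ p) {f : EuclideanSpace ℝ (Fin n) → 𝕜}
    (hf : AEStronglyMeasurable f (volume.restrict G))
    {x z : EuclideanSpace ℝ (Fin n)} (hx : x ∈ G) (hz : z ∈ G)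
    (hxz : dist x z ≤ N * infDist x (frontier G))
    (hzd : N * infDist x (frontier G) / β ≤ infDist z (frontier G)) :
    ‖f x‖ₑ ^ p * ENNReal.ofReal (infDist x (frontier G) ^ (-σ)) ≤
      ENNReal.ofReal (2 ^ p * ((2 * β) ^ n /
          (volume (ball (0 : EuclideanSpace ℝ (Fin n)) 1)).toReal * N ^ (-(n : ℝ)))) *
        (ENNReal.ofReal (infDist x (frontier G) ^ (-(σ + n))) *
            (∫⁻ y in accessiblePoints G N β x, ‖f y‖ₑ ^ p) +
          ENNReal.ofReal ((2 * N) ^ (σ + n)) *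
            ∫⁻ y in G, ‖f x - f y‖ₑ ^ p / edist x y ^ (n + σ)) := by
  have hAG : accessiblePoints G N β x ⊆ G := fun y hy => hy.1
  have hAx : MeasurableSet (accessiblePoints G N β x) :=
    measurable_prodMk_left (measurableSet_accessiblePoints hG N β)
  have hg : AEMeasurable (fun y => ‖f y‖ₑ ^ p) (volume.restrict (accessiblePoints G N β x)) :=
    (hf.enorm.pow_const p).mono_measure (Measure.restrict_mono hAG le_rfl)
  refine (rpow_mul_le_lintegral_accessiblePoints hG hF hβ hN hx hz hxz hzd _).trans ?_
  rw [ENNReal.ofReal_mul (p := 2 ^ p) (by positivity), mul_comm (ENNReal.ofReal (2 ^ p)),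
    mul_assoc (ENNReal.ofReal _)]
  gcongr ENNReal.ofReal _ * ?_
  set W := ENNReal.ofReal (infDist x (frontier G) ^ (-(σ + n))) with hW
  calc W * ∫⁻ _y in accessiblePoints G N β x, ‖f x‖ₑ ^ p
      ≤ W * ∫⁻ y in accessiblePoints G N β x, 2 ^ p * (‖f y‖ₑ ^ p + ‖f x - f y‖ₑ ^ p) := by
        gcongr with y
        exact enorm_rpow_le_two_rpow_mul _ _ hp
    _ = ENNReal.ofReal (2 ^ p) * (W * (∫⁻ y in accessiblePoints G N β x, ‖f y‖ₑ ^ p) +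
          ∫⁻ y in accessiblePoints G N β x, W * ‖f x - f y‖ₑ ^ p) := by
        rw [lintegral_const_mul' _ _ (by finiteness), lintegral_add_left' hg,
          lintegral_const_mul' _ _ ENNReal.ofReal_ne_top,
          ← ENNReal.ofReal_rpow_of_pos two_pos, ENNReal.ofReal_ofNat]
        ring
    _ ≤ _ := by
        gcongr
        rw [← lintegral_const_mul' _ _ ENNReal.ofReal_ne_top]
        refine (setLIntegral_mono' hAx fun y hy => ?_).trans (lintegral_mono_set hAG)
        rw [add_comm (n : ℝ) σ]
        exact ofReal_rpow_mul_le_div_edist hG hF (by positivity) hN hx hy _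

/-! ### Absorption and the Hardy inequality -/

/-- The Hardy inequality on `{x ∈ G | ε < infDist x (frontier G)}`, with a constant independent of
`ε`. The truncation makes the left-hand side finite, which the absorption requires. -/
theorem exists_truncated_hardy [NeZero n] {𝕜 : Type*} [NormedAddCommGroup 𝕜] (hG : IsOpen G)
    (hF : (frontier G).Nonempty) {β R : ℝ} (hβ : 1 ≤ β) (hR : 0 < R)
    (hplump : ∀ x ∈ G, ∀ ρ : ℝ, 0 ≤ ρ → ρ + infDist x (frontier G) ≤ R →
      ∃ z ∈ G, dist x z ≤ ρ ∧ ρ / β ≤ infDist z (frontier G))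
    {t C σ p : ℝ} (hσ : 0 ≤ σ) (ht : 0 ≤ t) (hσt : σ + t < n) (hp : 0 ≤ p)
    (hC : ∀ x ∈ frontier G, ∀ r : ℝ, 0 < r →
      ∫⁻ y in ball x r, infEDist y (frontier G) ^ (t - n) ≤ ENNReal.ofReal (C * r ^ t)) :
    ∃ K : ℝ, 0 < K ∧ ∀ f : EuclideanSpace ℝ (Fin n) → 𝕜,
      AEStronglyMeasurable f (volume.restrict G) → ∫⁻ x in G, ‖f x‖ₑ ^ p ≠ ∞ → ∀ ε : ℝ, 0 < ε →
      ∫⁻ x in {x ∈ G | ε < infDist x (frontier G)},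
          ‖f x‖ₑ ^ p * ENNReal.ofReal (infDist x (frontier G) ^ (-σ)) ≤
        ENNReal.ofReal K * ((∫⁻ x in G, ‖f x‖ₑ ^ p) +
          ∫⁻ x in G, ∫⁻ y in G, ‖f x - f y‖ₑ ^ p / edist x y ^ (n + σ)) := by
  have hv : 0 < (volume (ball (0 : EuclideanSpace ℝ (Fin n)) 1)).toReal :=
    ENNReal.toReal_pos (measure_ball_pos _ _ one_pos).ne' measure_ball_lt_top.ne
  set v := (volume (ball (0 : EuclideanSpace ℝ (Fin n)) 1)).toReal with hvdef
  obtain ⟨N, hNβ, hN⟩ : ∃ N : ℝ, 2 * β ≤ N ∧ 2 ^ p * ((2 * β) ^ n / v * N ^ (-(n : ℝ))) *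
      ((3 * N)⁻¹ ^ (-(σ + t)) * (C * (4 * β + 2) ^ t)) ≤ 1 / 2 := by
    have h := (tendsto_rpow_neg_atTop (y := n - (σ + t)) (by linarith)).const_mul
      (2 ^ p * ((2 * β) ^ n / v) * (3 ^ (σ + t) * (C * (4 * β + 2) ^ t)))
    rw [mul_zero] at h
    obtain ⟨N, hN, hNβ⟩ := ((h.eventually_le_const one_half_pos).and
      (eventually_ge_atTop (2 * β))).exists
    have hN0 : 0 < N := by linarith
    refine ⟨N, hNβ, le_of_eq_of_le ?_ hN⟩
    rw [Real.inv_rpow (by positivity), ← Real.rpow_neg (by positivity), neg_neg,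
      Real.mul_rpow (by norm_num) hN0.le, show -(n - (σ + t)) = -(n : ℝ) + (σ + t) by ring,
      Real.rpow_add hN0 (-(n : ℝ))]
    ring
  have hN0 : 0 < N := by linarith
  set c := 2 ^ p * ((2 * β) ^ n / v * N ^ (-(n : ℝ))) with hc
  set c' := (3 * N)⁻¹ ^ (-(σ + t)) * (C * (4 * β + 2) ^ t) with hc'
  have hc0 : 0 < c := by positivity
  set δ := (R / (N + 1)) ^ (-σ) with hδ
  have hδ0 : 0 < δ := by positivity
  refine ⟨2 * (δ + c * (2 * N) ^ (σ + n)), by positivity, fun f hf hfp ε hε => ?_⟩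
  have hSmeas : MeasurableSet {x ∈ G | ε < infDist x (frontier G)} :=
    hG.measurableSet.inter (measurableSet_lt measurable_const measurable_infDist)
  have key := lintegral_lintegral_accessiblePoints_le hG hF (σ := σ) (ε := ε) (by linarith) hC hβ
    hNβ (hf.enorm.pow_const p)
  set S := {x ∈ G | ε < infDist x (frontier G)}
  have hSG : S ⊆ G := fun x hx => hx.1
  have hmeas := (aemeasurable_mul_lintegral_accessiblePoints hG N β (-(σ + n))
    (hf.enorm.pow_const p)).mono_measure (Measure.restrict_mono hSG le_rfl)
  set J := ∫⁻ x in S, ‖f x‖ₑ ^ p * ENNReal.ofReal (infDist x (frontier G) ^ (-σ)) with hJ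
  set Q := ∫⁻ x in G, ∫⁻ y in G, ‖f x - f y‖ₑ ^ p / edist x y ^ (n + σ) with hQ
  set P := ∫⁻ x in G, ‖f x‖ₑ ^ p with hP
  have hJtop : J ≠ ∞ := by
    refine ne_top_of_le_ne_top (ENNReal.mul_ne_top ENNReal.ofReal_ne_top hfp :
      ENNReal.ofReal (ε ^ (-σ)) * P ≠ ∞) ?_
    rw [hP, ← lintegral_const_mul' _ _ ENNReal.ofReal_ne_top]
    refine (setLIntegral_mono' hSmeas fun x hx => ?_).trans (lintegral_mono_set hSG)
    rw [mul_comm]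
    gcongr ENNReal.ofReal ?_ * _
    exact Real.rpow_le_rpow_of_nonpos hε hx.2.le (by linarith)
  have hpt : ∀ x ∈ S, ‖f x‖ₑ ^ p * ENNReal.ofReal (infDist x (frontier G) ^ (-σ)) ≤
      ENNReal.ofReal c * (ENNReal.ofReal (infDist x (frontier G) ^ (-(σ + n))) *
        ∫⁻ y in accessiblePoints G N β x, ‖f y‖ₑ ^ p) +
      (ENNReal.ofReal δ * ‖f x‖ₑ ^ p + ENNReal.ofReal (c * (2 * N) ^ (σ + n)) *
        ∫⁻ y in G, ‖f x - f y‖ₑ ^ p / edist x y ^ (n + σ)) := by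
    intro x hx
    -- Plumpness is available only near the boundary; elsewhere the weight is bounded.
    rcases le_or_gt (N * infDist x (frontier G) + infDist x (frontier G)) R with h | h
    · obtain ⟨z, hz, hxz, hzd⟩ := hplump x hx.1 _ (mul_nonneg hN0.le infDist_nonneg) h
      refine (rpow_enorm_mul_le hG hF hβ hN0 hσ hp hf hx.1 hz hxz hzd).trans ?_
      rw [mul_add, ← mul_assoc (ENNReal.ofReal _) (ENNReal.ofReal ((2 * N) ^ (σ + n))),
        ← ENNReal.ofReal_mul hc0.le]
      gcongr
      exact le_add_self
    · refine le_trans ?_ (le_self_add.trans le_add_self)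
      rw [mul_comm]
      gcongr ENNReal.ofReal ?_ * _
      refine Real.rpow_le_rpow_of_nonpos (by positivity) ?_ (by linarith)
      rw [div_le_iff₀ (by positivity)]
      linarith
  have hJle : J ≤ J / 2 + ENNReal.ofReal (δ + c * (2 * N) ^ (σ + n)) * (P + Q) := by
    calc J ≤ _ := setLIntegral_mono' hSmeas hpt
      _ = ENNReal.ofReal c * (∫⁻ x in S, (ENNReal.ofReal (infDist x (frontier G) ^ (-(σ + n))) *
            ∫⁻ y in accessiblePoints G N β x, ‖f y‖ₑ ^ p)) +
          (ENNReal.ofReal δ * (∫⁻ x in S, ‖f x‖ₑ ^ p) + ENNReal.ofReal (c * (2 * N) ^ (σ + n)) *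
            ∫⁻ x in S, ∫⁻ y in G, ‖f x - f y‖ₑ ^ p / edist x y ^ (n + σ)) := by
          rw [lintegral_add_left' (hmeas.const_mul _), lintegral_add_left',
            lintegral_const_mul' _ _ ENNReal.ofReal_ne_top,
            lintegral_const_mul' _ _ ENNReal.ofReal_ne_top,
            lintegral_const_mul' _ _ ENNReal.ofReal_ne_top]
          exact ((hf.enorm.pow_const p).mono_measure
            (Measure.restrict_mono hSG le_rfl)).const_mul _
      _ ≤ ENNReal.ofReal c * (ENNReal.ofReal c' * J) +
          (ENNReal.ofReal δ * P + ENNReal.ofReal (c * (2 * N) ^ (σ + n)) * Q) := by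
          gcongr <;> exact lintegral_mono_set hSG
      _ ≤ _ := by
          gcongr
          · rw [← mul_assoc, ← ENNReal.ofReal_mul hc0.le, div_eq_mul_inv, mul_comm J]
            gcongr
            refine (ENNReal.ofReal_le_ofReal hN).trans_eq ?_
            rw [one_div, ENNReal.ofReal_inv_of_pos two_pos, ENNReal.ofReal_ofNat]
          · rw [mul_add]
            gcongr <;> nlinarith [show 0 ≤ c * (2 * N) ^ (σ + n) by positivity]
  have hhalf : J / 2 ≤ ENNReal.ofReal (δ + c * (2 * N) ^ (σ + n)) * (P + Q) := by
    refine ENNReal.le_of_add_le_add_left (ENNReal.div_ne_top hJtop two_ne_zero) ?_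
    rwa [ENNReal.add_halves]
  rw [ENNReal.ofReal_mul two_pos.le, ENNReal.ofReal_ofNat, mul_assoc, mul_comm]
  exact (ENNReal.div_le_iff two_ne_zero ENNReal.ofNat_ne_top).1 hhalf

end

theorem theorem1p1 {𝕜 : Type*} [RCLike 𝕜] (n : ℕ) (hn : 2 ≤ n) (p s : ℝ) (hp : 1 < p)
    (hs0 : 0 < s) (hs : s < min 1 ((n : ℝ) / p)) (G : Set (EuclideanSpace ℝ (Fin n)))
    (hG : IsJohnDomain G) (hdim : aikawaDim (frontier G) < n - s * p) :
    ∃ C : ℝ, 0 < C ∧ ∀ f : EuclideanSpace ℝ (Fin n) → 𝕜,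
      MemLp f (ENNReal.ofReal p) (volume.restrict G) →
      (∫⁻ x in G, ‖f x‖ₑ ^ p / infEDist x (frontier G) ^ (s * p)) ^ (1 / p) ≤
        ENNReal.ofReal C *
          (eLpNorm f (ENNReal.ofReal p) (volume.restrict G) + fracSeminorm s p G f) := by
  have : NeZero n := ⟨by lia⟩
  have hp0 : 0 < p := by linarith
  obtain ⟨hGo, hGc, hGb, -⟩ := id hG
  have hF : (frontier G).Nonempty := by
    refine nonempty_frontier_iff.2 ⟨hGc.nonempty, fun h => ?_⟩
    exact NormedSpace.unbounded_univ ℝ (EuclideanSpace ℝ (Fin n)) (h ▸ hGb)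
  obtain ⟨t, ⟨ht0, -, C, -, hC⟩, ht⟩ :=
    exists_lt_of_csInf_lt ⟨_, natCast_mem_aikawaSet (by lia) _⟩ hdim
  obtain ⟨β, hβ, R, hR, hplump⟩ := hG.exists_plump hF
  obtain ⟨K, hK, h⟩ := exists_truncated_hardy (𝕜 := 𝕜) hGo hF hβ hR hplump (σ := s * p) (p := p)
    (by positivity) ht0.le (by linarith) hp0.le hC
  refine ⟨K ^ (1 / p), by positivity, fun f hf => ?_⟩
  have hp' : (ENNReal.ofReal p).toReal = p := ENNReal.toReal_ofReal hp0.le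
  have hnorm : eLpNorm f (ENNReal.ofReal p) (volume.restrict G) =
      (∫⁻ x in G, ‖f x‖ₑ ^ p) ^ (1 / p) := by
    rw [eLpNorm_eq_lintegral_rpow_enorm_toReal (by simpa using hp0) ENNReal.ofReal_ne_top, hp']
  have hfin : ∫⁻ x in G, ‖f x‖ₑ ^ p ≠ ∞ := by
    have h2 := hf.2.ne
    rw [hnorm] at h2
    exact fun h3 => h2 (by rw [h3, ENNReal.top_rpow_of_pos (by positivity)])
  have hint : ∫⁻ x in G, ‖f x‖ₑ ^ p / infEDist x (frontier G) ^ (s * p) ≤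
      ENNReal.ofReal K * ((∫⁻ x in G, ‖f x‖ₑ ^ p) +
        ∫⁻ x in G, ∫⁻ y in G, ‖f x - f y‖ₑ ^ p / edist x y ^ (n + s * p)) := by
    have hU : G = ⋃ k : ℕ, {x ∈ G | 1 / ((k : ℝ) + 1) < infDist x (frontier G)} := by
      ext x
      simp only [mem_iUnion, mem_ofPred_eq, exists_and_left]
      exact ⟨fun hx => ⟨hx, exists_nat_one_div_lt (infDist_frontier_pos hGo hF hx)⟩, And.left⟩
    have hmono : Monotone fun k : ℕ =>
        {x ∈ G | 1 / ((k : ℝ) + 1) < infDist x (frontier G)} := fun i j hij x hx =>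
      ⟨hx.1, (Nat.one_div_le_one_div hij).trans_lt hx.2⟩
    have hcongr : ∫⁻ x in G, ‖f x‖ₑ ^ p / infEDist x (frontier G) ^ (s * p) =
        ∫⁻ x in G, ‖f x‖ₑ ^ p * ENNReal.ofReal (infDist x (frontier G) ^ (-(s * p))) := by
      refine setLIntegral_congr_fun hGo.measurableSet fun x hx => ?_
      simp only [← infEDist_frontier_rpow hGo hF hx, ENNReal.rpow_neg, div_eq_mul_inv]
    have hsup := setLIntegral_iUnion_of_directed (μ := volume)
      (fun x => ‖f x‖ₑ ^ p * ENNReal.ofReal (infDist x (frontier G) ^ (-(s * p))))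
      hmono.directed_le
    rw [← hU] at hsup
    rw [hcongr, hsup]
    exact iSup_le fun k => h f hf.1 hfin _ (by positivity)
  calc _ ≤ (ENNReal.ofReal K * ((∫⁻ x in G, ‖f x‖ₑ ^ p) +
        ∫⁻ x in G, ∫⁻ y in G, ‖f x - f y‖ₑ ^ p / edist x y ^ (n + s * p))) ^ (1 / p) := by
        gcongr
    _ ≤ _ := by
        rw [ENNReal.mul_rpow_of_nonneg _ _ (by positivity), ENNReal.ofReal_rpow_of_pos hK,
          hnorm, fracSeminorm]
        gcongr
        exact ENNReal.rpow_add_le_add_rpow _ _ (by positivity)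
          (by rw [div_le_one hp0]; exact hp.le)
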